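/- Let $m\le q$, $n\le p$, $a_j,b_j\in\mathbb{C}$, $A_j,B_j>0$. For $z\in\mathbb{C}\setminus\{0\}$ the H-function is $$H^{m,n}_{p,q}\left[z\,\middle|\begin{array}{c}(a_1,A_1),\ldots,(a_p,A_p)\\(b_1,B_1),\ldots,(b_q,B_q)\end{array}\right]=\frac1{2\pi i}\int_L\frac{\prod_{j=1}^m\Gamma(b_j+B_js)\prod_{j=1}^n\Gamma(1-a_j-A_js)}{\prod_{j=m+1}^q\Gamma(1-b_j-B_js)\prod_{j=n+1}^p\Gamma(a_j+A_js)}\,z^{-s}\,ds ,$$ where $L$ keeps the poles of $\Gamma(b_j+B_js)$, $1\le j\le m$, on its left and those of $\Gamma(1-a_j-A_js)$, $1\le j\le n$, on its right. If $\sum_j B_j>\sum_j A_j$ (the case needed here), $L$ is a loop $L_{-\infty}$: for real numbers $c$ and $u<v$ it runs from $-\infty+iu$ to $c+iu$, then to $c+iv$, then to $-\infty+iv$, along straight lines, the left poles lying in $\{\operatorname{Re}s<c,\ u<\operatorname{Im}s<v\}$ and the right poles in $\{\operatorname{Re}s>c\}$. All powers are principal powers. Let $x\in\mathbb{R}\setminus\{0\}$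 and $\alpha\in\mathbb{C}$. Then along every such loop the integral defining $H^{1,1}_{1,2}\left[-x^{\alpha}\,\middle|\begin{array}{c}(0,1)\\(0,1),(0,2)\end{array}\right]$ converges absolutely, its value does not depend on the loop, and $$\sum_{k=0}^\infty\frac{x^{\alpha k}}{(2k)!}=H^{1,1}_{1,2}\left[-x^{\alpha}\,\middle|\begin{array}{c}(0,1)\\(0,1),(0,2)\end{array}\right]=\tfrac12e^{x^{\alpha/2}}+\tfrac12e^{-x^{\alpha/2}}=\cosh\left(x^{\alpha/2}\right),$$ the series being absolutely convergent. If $x=0$ and $\operatorname{Re}\alpha>0$ (where the H-function is not defined), one still has $\sum_{k=0}^\infty x^{\alpha k}/(2k)!=\cosh(x^{\alpha/2})$, the term $k=0$ being $1$. -/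

import Mathlib

open Complex MeasureTheory Set

noncomputable section

/-- The Mellin--Barnes kernel
`∏_{j≤m} Γ(b_j + B_j s) ∏_{j≤n} Γ(1 - a_j - A_j s) /
  (∏_{m<j≤q} Γ(1 - b_j - B_j s) ∏_{n<j≤p} Γ(a_j + A_j s))`.
Indices are shifted to start at `0`. At the poles of a Gamma factor of the denominator its
reciprocal takes the value `0`, which is the value of the entire function `1 / Γ` there. -/
def foxKernel (m n : ℕ) {p q : ℕ} (a : Fin p → ℂ) (A : Fin p → ℝ)
    (b : Fin q → ℂ) (B : Fin q → ℝ) (s : ℂ) : ℂ :=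
  (∏ j : Fin q, if (j : ℕ) < m then Gamma (b j + B j * s) else (Gamma (1 - b j - B j * s))⁻¹) *
  (∏ j : Fin p, if (j : ℕ) < n then Gamma (1 - a j - A j * s) else (Gamma (a j + A j * s))⁻¹)

/-- The integrand `kernel(s) z^{-s}`, with `z^{-s} = exp (-s (log |z| + i arg z))`. -/
def foxIntegrand (m n : ℕ) {p q : ℕ} (a : Fin p → ℂ) (A : Fin p → ℝ)
    (b : Fin q → ℂ) (B : Fin q → ℝ) (z s : ℂ) : ℂ :=
  foxKernel m n a A b B s * z ^ (-s)

/-- The poles of the factors `Γ(b_j + B_j s)`, `j ≤ m`; they must lie to the left of the contour. -/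
def foxLeftPoles (m : ℕ) {q : ℕ} (b : Fin q → ℂ) (B : Fin q → ℝ) : Set ℂ :=
  {s | ∃ j : Fin q, (j : ℕ) < m ∧ ∃ k : ℕ, s = -(b j + k) / B j}

/-- The poles of the factors `Γ(1 - a_j - A_j s)`, `j ≤ n`; they must lie to the right of the
contour. -/
def foxRightPoles (n : ℕ) {p : ℕ} (a : Fin p → ℂ) (A : Fin p → ℝ) : Set ℂ :=
  {s | ∃ j : Fin p, (j : ℕ) < n ∧ ∃ k : ℕ, s = (1 - a j + k) / A j}

/-- `∑ B_j - ∑ A_j`, which decides at which end the contour closes. -/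
def foxDelta {p q : ℕ} (A : Fin p → ℝ) (B : Fin q → ℝ) : ℝ := (∑ j, B j) - ∑ j, A j

/-- `D = ∏ A_j ^ A_j / ∏ B_j ^ B_j`. -/
def foxD {p q : ℕ} (A : Fin p → ℝ) (B : Fin q → ℝ) : ℝ := (∏ j, A j ^ A j) / ∏ j, B j ^ B j

/-- The data `(c, u, v)` of a loop `L_{-∞}`, which runs from `-∞ + i u` horizontally to `c + i u`,
then vertically to `c + i v`, and then horizontally to `-∞ + i v`. It has to keep the left poles on
its left (inside the loop) and the right poles on its right. -/
def IsLeftLoop (m n : ℕ) {p q : ℕ} (a : Fin p → ℂ) (A : Fin p → ℝ)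
    (b : Fin q → ℂ) (B : Fin q → ℝ) (c u v : ℝ) : Prop :=
  u < v ∧ (∀ s ∈ foxLeftPoles m b B, s.re < c ∧ u < s.im ∧ s.im < v) ∧
    ∀ s ∈ foxRightPoles n a A, c < s.re

/-- The data `(c, u, v)` of a loop `L_{+∞}`, which runs from `+∞ + i u` horizontally to `c + i u`,
then vertically to `c + i v`, and then horizontally to `+∞ + i v`. -/
def IsRightLoop (m n : ℕ) {p q : ℕ} (a : Fin p → ℂ) (A : Fin p → ℝ)
    (b : Fin q → ℂ) (B : Fin q → ℝ) (c u v : ℝ) : Prop :=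
  u < v ∧ (∀ s ∈ foxLeftPoles m b B, s.re < c) ∧
    ∀ s ∈ foxRightPoles n a A, c < s.re ∧ u < s.im ∧ s.im < v

/-- `f` is absolutely integrable along the loop `L_{-∞}` with data `(c, u, v)`. -/
def LeftLoopIntegrable (f : ℂ → ℂ) (c u v : ℝ) : Prop :=
  IntegrableOn (fun r : ℝ => f (r + u * I)) (Iic c) ∧
  IntervalIntegrable (fun t : ℝ => f (c + t * I)) volume u v ∧
  IntegrableOn (fun r : ℝ => f (r + v * I)) (Iic c)

/-- The contour integral `∫ f(s) ds` along the loop `L_{-∞}` with data `(c, u, v)`. -/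
def leftLoopIntegral (f : ℂ → ℂ) (c u v : ℝ) : ℂ :=
  (∫ r in Iic c, f (r + u * I)) + I * (∫ t in u..v, f (c + t * I)) - ∫ r in Iic c, f (r + v * I)

/-- `f` is absolutely integrable along the loop `L_{+∞}` with data `(c, u, v)`. -/
def RightLoopIntegrable (f : ℂ → ℂ) (c u v : ℝ) : Prop :=
  IntegrableOn (fun r : ℝ => f (r + u * I)) (Ici c) ∧
  IntervalIntegrable (fun t : ℝ => f (c + t * I)) volume u v ∧
  IntegrableOn (fun r : ℝ => f (r + v * I)) (Ici c)

/-- The contour integral `∫ f(s) ds` along the loop `L_{+∞}` with data `(c, u, v)`. -/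
def rightLoopIntegral (f : ℂ → ℂ) (c u v : ℝ) : ℂ :=
  -(∫ r in Ici c, f (r + u * I)) + I * (∫ t in u..v, f (c + t * I)) + ∫ r in Ici c, f (r + v * I)

/-- `w` is the value at `z ≠ 0` of the H-function
`H^{m,n}_{p,q}[z | (a_1,A_1),…,(a_p,A_p); (b_1,B_1),…,(b_q,B_q)]`:
a pole-separating contour exists, and along each such contour the Mellin--Barnes integral converges
absolutely and `(2πi)⁻¹ ∫_L kernel(s) z^{-s} ds = w`. The contour closes at `-∞` if
`∑ B_j > ∑ A_j`, or if `∑ B_j = ∑ A_j` and `|z| < D⁻¹`; it closes at `+∞` if `∑ B_j < ∑ A_j`, or if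
`∑ B_j = ∑ A_j` and `|z| > D⁻¹`. -/
def HasFoxH (m n : ℕ) {p q : ℕ} (a : Fin p → ℂ) (A : Fin p → ℝ)
    (b : Fin q → ℂ) (B : Fin q → ℝ) (z w : ℂ) : Prop :=
  m ≤ q ∧ n ≤ p ∧ (∀ j, 0 < A j) ∧ (∀ j, 0 < B j) ∧ z ≠ 0 ∧
  (((0 < foxDelta A B ∨ foxDelta A B = 0 ∧ ‖z‖ < (foxD A B)⁻¹) ∧
      (∃ c u v : ℝ, IsLeftLoop m n a A b B c u v) ∧
      ∀ c u v : ℝ, IsLeftLoop m n a A b B c u v →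
        LeftLoopIntegrable (foxIntegrand m n a A b B z) c u v ∧
        (2 * Real.pi * I)⁻¹ * leftLoopIntegral (foxIntegrand m n a A b B z) c u v = w) ∨
   ((foxDelta A B < 0 ∨ foxDelta A B = 0 ∧ (foxD A B)⁻¹ < ‖z‖) ∧
      (∃ c u v : ℝ, IsRightLoop m n a A b B c u v) ∧
      ∀ c u v : ℝ, IsRightLoop m n a A b B c u v →
        RightLoopIntegrable (foxIntegrand m n a A b B z) c u v ∧
        (2 * Real.pi * I)⁻¹ * rightLoopIntegral (foxIntegrand m n a A b B z) c u v = w))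

open Classical in
/-- The H-function `H^{m,n}_{p,q}[z | (a_1,A_1),…,(a_p,A_p); (b_1,B_1),…,(b_q,B_q)]`
(with the value `0` where it is not defined). -/
def foxH (m n : ℕ) {p q : ℕ} (a : Fin p → ℂ) (A : Fin p → ℝ)
    (b : Fin q → ℂ) (B : Fin q → ℝ) (z : ℂ) : ℂ :=
  if h : ∃ w, HasFoxH m n a A b B z w then h.choose else 0

/-- The value of the H-function is unique. -/
theorem HasFoxH.unique {m n p q : ℕ} {a : Fin p → ℂ} {A : Fin p → ℝ}
    {b : Fin q → ℂ} {B : Fin q → ℝ} {z w w' : ℂ}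
    (h : HasFoxH m n a A b B z w) (h' : HasFoxH m n a A b B z w') : w = w' := by
  obtain ⟨-, -, -, -, -, h⟩ := h
  obtain ⟨-, -, -, -, -, h'⟩ := h'
  rcases h with ⟨r, ⟨c, u, v, hL⟩, hw⟩ | ⟨r, ⟨c, u, v, hL⟩, hw⟩ <;>
  rcases h' with ⟨r', -, hw'⟩ | ⟨r', -, hw'⟩
  · exact (hw c u v hL).2.symm.trans (hw' c u v hL).2
  · exfalso
    rcases r with r | ⟨r, s⟩ <;> rcases r' with r' | ⟨r', s'⟩ <;> linarith
  · exfalso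
    rcases r with r | ⟨r, s⟩ <;> rcases r' with r' | ⟨r', s'⟩ <;> linarith
  · exact (hw c u v hL).2.symm.trans (hw' c u v hL).2

/-- `foxH` takes the value singled out by `HasFoxH`. -/
theorem HasFoxH.foxH_eq {m n p q : ℕ} {a : Fin p → ℂ} {A : Fin p → ℝ}
    {b : Fin q → ℂ} {B : Fin q → ℝ} {z w : ℂ}
    (h : HasFoxH m n a A b B z w) : foxH m n a A b B z = w := by
  have hex : ∃ w, HasFoxH m n a A b B z w := ⟨w, h⟩
  rw [foxH, dif_pos hex]
  exact hex.choose_spec.unique h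

end

open Complex MeasureTheory Set Filter Topology

/-! By the reflection formula the integrand is `π / sin (π s)` times the entire function `z ^ (-s) /
Γ(1 - 2 s)`. Inside a loop its only singularities are the simple poles `s = -k`, with residue `(-z)
^ k / (2 k)!`. On rectangles whose left edge is `Re s = -n - 1/2` the residue theorem gives partial
sums (`rectBoundaryIntegral_coshKernel_eq_sum`). As `n → ∞` the left edge contributes nothing,
because `1 / Γ` beats every exponential (`exists_norm_Gamma_inv_le`) and the sine stays away from
`0` there. The loop integral is thus `2 π i` times the full series, which for `z = -x ^ α` is the
Taylor series of `cosh` at `x ^ (α / 2)`. -/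

/-! ### Residue theorem on rectangles. -/

/-- The integral of `f` along the boundary of the rectangle `[a, b] × [u, v]`, anticlockwise. -/
noncomputable def rectBoundaryIntegral (f : ℂ → ℂ) (a b u v : ℝ) : ℂ :=
  (∫ r in a..b, f (r + u * I)) - (∫ r in a..b, f (r + v * I)) +
    I * (∫ t in u..v, f (b + t * I)) - I * ∫ t in u..v, f (a + t * I)

theorem integral_horizontal_inv_sub (p : ℂ) (a b : ℝ) {u : ℝ} (hu : u ≠ p.im) :
    ∫ r in a..b, ((r : ℂ) + u * I - p)⁻¹ = log (b + u * I - p) - log (a + u * I - p) := by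
  have hs (r : ℝ) : (r : ℂ) + u * I - p ∈ slitPlane :=
    Or.inr (by simpa [sub_eq_zero] using hu)
  refine intervalIntegral.integral_eq_sub_of_hasDerivAt
    (f := fun r : ℝ => log ((r : ℂ) + u * I - p)) (fun r _ => ?_) ?_
  · have h : HasDerivAt (fun r : ℝ => (r : ℂ) + u * I - p) 1 r :=
      ((hasDerivAt_id r).ofReal_comp.add_const _).sub_const _
    simpa using h.clog_real (hs r)
  · refine Continuous.intervalIntegrable ?_ _ _
    exact Continuous.inv₀ (by fun_prop) fun r => slitPlane_ne_zero (hs r)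

theorem integral_vertical_inv_sub_of_re_lt (p : ℂ) {b : ℝ} (u v : ℝ) (hb : p.re < b) :
    I * ∫ t in u..v, ((b : ℂ) + t * I - p)⁻¹ = log (b + v * I - p) - log (b + u * I - p) := by
  have hs (t : ℝ) : (b : ℂ) + t * I - p ∈ slitPlane :=
    Or.inl (by simpa [sub_eq_zero] using hb)
  rw [← intervalIntegral.integral_const_mul]
  refine intervalIntegral.integral_eq_sub_of_hasDerivAt
    (f := fun t : ℝ => log ((b : ℂ) + t * I - p)) (fun t _ => ?_) ?_
  · have h : HasDerivAt (fun t : ℝ => (b : ℂ) + t * I - p) I t := by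
      simpa using ((((hasDerivAt_id t).ofReal_comp).mul_const I).const_add (b : ℂ)).sub_const p
    simpa [div_eq_mul_inv] using h.clog_real (hs t)
  · refine Continuous.intervalIntegrable ?_ _ _
    exact continuous_const.mul (Continuous.inv₀ (by fun_prop) fun r => slitPlane_ne_zero (hs r))

/-- Left of `p` the edge crosses the branch cut of `log (s - p)`, so `log (-(s - p))` serves as
primitive; the point reflection `s ↦ -s` reduces to the edge on the right. -/
theorem integral_vertical_inv_sub_of_lt_re (p : ℂ) {a : ℝ} (u v : ℝ) (ha : a < p.re) :
    I * ∫ t in u..v, ((a : ℂ) + t * I - p)⁻¹ =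
      log (-(a + v * I - p)) - log (-(a + u * I - p)) := by
  have h := integral_vertical_inv_sub_of_re_lt (-p) (b := -a) (-u) (-v) (by simpa using ha)
  rw [← intervalIntegral.integral_comp_neg
    (f := fun t : ℝ => (((-a : ℝ) : ℂ) + (t : ℂ) * I - -p)⁻¹)] at h
  rw [intervalIntegral.integral_symm] at h
  have e (t : ℝ) : (((-a : ℝ) : ℂ) + ((-t : ℝ) : ℂ) * I - -p) = -((a : ℂ) + t * I - p) := by
    push_cast; ring
  simp only [e, inv_neg, intervalIntegral.integral_neg, neg_neg] at h
  exact h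

theorem log_sub_log_neg_of_im_pos {w : ℂ} (hw : 0 < w.im) :
    log w - log (-w) = Real.pi * I := by
  simp only [log, norm_neg, arg_neg_eq_arg_sub_pi_of_im_pos hw]
  push_cast; ring

theorem rectBoundaryIntegral_inv_sub {p : ℂ} {a b u v : ℝ} (ha : a < p.re) (hb : p.re < b)
    (hu : u < p.im) (hv : p.im < v) :
    rectBoundaryIntegral (fun s => (s - p)⁻¹) a b u v = 2 * Real.pi * I := by
  rw [rectBoundaryIntegral, integral_horizontal_inv_sub p a b hu.ne,
    integral_horizontal_inv_sub p a b hv.ne', integral_vertical_inv_sub_of_re_lt p u v hb,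
    integral_vertical_inv_sub_of_lt_re p u v ha]
  -- The logarithms telescope except at the two left corners, where the change of branch gives `π i`
  -- each.
  have h₁ := log_sub_log_neg_of_im_pos (w := a + v * I - p) (by simpa using hv)
  have h₂ := log_sub_log_neg_of_im_pos (w := -(a + u * I - p)) (by simpa using hu)
  rw [neg_neg] at h₂
  linear_combination h₁ + h₂

theorem rectBoundaryIntegral_eq_zero {f : ℂ → ℂ} {a b u v : ℝ} (hab : a ≤ b)
    (hf : DifferentiableOn ℂ f {s | s.re ∈ Icc a b}) : rectBoundaryIntegral f a b u v = 0 := by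
  have h := integral_boundary_rect_eq_zero_of_differentiableOn f (a + u * I) (b + v * I)
    (hf.mono fun s hs => by
      have := hs.1
      simpa [uIcc_of_le hab] using this)
  simpa [rectBoundaryIntegral] using h

/-- The residue theorem on a rectangle for a function `h s / (s - p)`. -/
theorem rectBoundaryIntegral_div_sub {h : ℂ → ℂ} {p : ℂ} {a b u v : ℝ}
    {U : Set ℂ} (hU : IsOpen U) (hsub : {s | s.re ∈ Icc a b} ⊆ U) (hh : DifferentiableOn ℂ h U)
    (ha : a < p.re) (hb : p.re < b) (hu : u < p.im) (hv : p.im < v) :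
    rectBoundaryIntegral (fun s => h s / (s - p)) a b u v = 2 * Real.pi * I * h p := by
  have hpU : p ∈ U := hsub ⟨ha.le, hb.le⟩
  -- Removable singularity: `h s / (s - p)` is the holomorphic `dslope h p` plus `h p / (s - p)`.
  have hd : DifferentiableOn ℂ (dslope h p) U :=
    (differentiableOn_dslope (hU.mem_nhds hpU)).2 hh
  have h0 := rectBoundaryIntegral_eq_zero (u := u) (v := v) (ha.trans hb).le (hd.mono hsub)
  have h1 := rectBoundaryIntegral_inv_sub ha hb hu hv
  have hc : ContinuousOn (dslope h p) {s | s.re ∈ Icc a b} := (hd.mono hsub).continuousOn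
  have key (s : ℂ) (hs : s ≠ p) : h s / (s - p) = dslope h p s + h p * (s - p)⁻¹ := by
    rw [dslope_of_ne _ hs, slope_def_field]; ring
  have hor (y : ℝ) (hy : y ≠ p.im) :
      ∫ r in a..b, h (r + y * I) / (r + y * I - p) =
        (∫ r in a..b, dslope h p (r + y * I)) + h p * ∫ r in a..b, ((r : ℂ) + y * I - p)⁻¹ := by
    have hne (r : ℝ) : (r : ℂ) + y * I ≠ p := fun e => hy (by simp [← e])
    rw [← intervalIntegral.integral_const_mul, ← intervalIntegral.integral_add]
    · exact intervalIntegral.integral_congr fun r _ => key _ (hne r)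
    · refine ContinuousOn.intervalIntegrable (hc.comp (by fun_prop) fun r hr => ?_)
      simpa [uIcc_of_le (ha.trans hb).le] using hr
    · refine Continuous.intervalIntegrable (continuous_const.mul ?_) _ _
      exact Continuous.inv₀ (by fun_prop) fun r => sub_ne_zero.2 (hne r)
  have ver (x : ℝ) (hx : x ≠ p.re) (hxm : x ∈ Icc a b) :
      ∫ t in u..v, h (x + t * I) / (x + t * I - p) =
        (∫ t in u..v, dslope h p (x + t * I)) + h p * ∫ t in u..v, ((x : ℂ) + t * I - p)⁻¹ := by
    have hne (t : ℝ) : (x : ℂ) + t * I ≠ p := fun e => hx (by simp [← e])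
    rw [← intervalIntegral.integral_const_mul, ← intervalIntegral.integral_add]
    · exact intervalIntegral.integral_congr fun r _ => key _ (hne r)
    · refine ContinuousOn.intervalIntegrable (hc.comp (by fun_prop) fun r hr => ?_)
      simpa using hxm
    · refine Continuous.intervalIntegrable (continuous_const.mul ?_) _ _
      exact Continuous.inv₀ (by fun_prop) fun r => sub_ne_zero.2 (hne r)
  have hab := (ha.trans hb).le
  simp only [rectBoundaryIntegral] at h0 h1 ⊢
  rw [hor u hu.ne, hor v hv.ne', ver b hb.ne' ⟨hab, le_rfl⟩, ver a ha.ne ⟨le_rfl, hab⟩]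
  linear_combination h0 + h p * h1

/-! ### Decay of the entire factor. -/

/-- The reciprocal Gamma function decays faster than any exponential to the right in a horizontal
strip. -/
theorem exists_norm_Gamma_inv_le (T M : ℝ) :
    ∃ C, 0 ≤ C ∧ ∀ w : ℂ, -1 ≤ w.re → |w.im| ≤ T →
      ‖(Gamma w)⁻¹‖ ≤ C * Real.exp (-M * w.re) := by
  -- Once `Re (w - 1) > R`, the recurrence shrinks `1 / Γ` by a factor at most `1 / R = exp (-M)`
  -- per unit step, so a bound on a compact box propagates to the right.
  set R : ℝ := Real.exp M
  have hR : 0 < R := Real.exp_pos M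
  have hcont : Continuous fun w : ℂ => ‖(Gamma w)⁻¹‖ * Real.exp (M * w.re) :=
    differentiable_one_div_Gamma.continuous.norm.mul (by fun_prop)
  have hK : IsCompact (Icc (-1) (R + 1) ×ℂ Icc (-T) T) := isCompact_Icc.reProdIm isCompact_Icc
  obtain ⟨C, hC⟩ := hK.exists_bound_of_continuousOn hcont.continuousOn
  have main (n : ℕ) : ∀ w : ℂ, -1 ≤ w.re → w.re ≤ R + 1 + n → |w.im| ≤ T →
      ‖(Gamma w)⁻¹‖ * Real.exp (M * w.re) ≤ C := by
    induction n with
    | zero =>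
      intro w h1 h2 h3
      exact (le_abs_self _).trans (hC w ⟨⟨h1, by simpa using h2⟩, abs_le.1 h3⟩)
    | succ n ih =>
      intro w h1 h2 h3
      by_cases hw : w.re ≤ R + 1
      · exact ih w h1 (hw.trans (by simp)) h3
      push Not at hw
      have hre : R < (w - 1).re := by simp; linarith
      have hne : w - 1 ≠ 0 := fun e => by rw [e] at hre; simp at hre; linarith
      have hb := ih (w - 1) (by linarith) (by push_cast at h2; simp; linarith) (by simpa using h3)
      have hG : Gamma w = (w - 1) * Gamma (w - 1) := by
        rw [← Gamma_add_one _ hne, sub_add_cancel]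
      have hnorm : R ≤ ‖w - 1‖ := hre.le.trans (re_le_norm _)
      refine le_trans ?_ hb
      have hexp : Real.exp (M * w.re) = Real.exp (M * (w - 1).re) * R := by
        rw [← Real.exp_add]; simp; ring_nf
      rw [hG, mul_inv, norm_mul, norm_inv, hexp]
      calc ‖w - 1‖⁻¹ * ‖(Gamma (w - 1))⁻¹‖ * (Real.exp (M * (w - 1).re) * R)
          = (‖w - 1‖⁻¹ * R) * (‖(Gamma (w - 1))⁻¹‖ * Real.exp (M * (w - 1).re)) := by ring
        _ ≤ 1 * (‖(Gamma (w - 1))⁻¹‖ * Real.exp (M * (w - 1).re)) := by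
            gcongr
            rw [inv_mul_le_one₀ (hR.trans_le hnorm)]
            exact hnorm
        _ = _ := one_mul _
  refine ⟨max C 0, le_max_right _ _, fun w h1 h3 => ?_⟩
  obtain ⟨n, hn⟩ := exists_nat_ge (w.re - (R + 1))
  have h := (main n w h1 (by linarith) h3).trans (le_max_left C 0)
  rwa [neg_mul, Real.exp_neg, ← div_eq_mul_inv, le_div_iff₀ (Real.exp_pos _)]

/-- The entire factor `z ^ (-s) / Γ(1 - 2 s)` of the kernel. -/
noncomputable def entireFactor (z s : ℂ) : ℂ := (Gamma (1 - 2 * s))⁻¹ * z ^ (-s)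

theorem differentiable_entireFactor {z : ℂ} (hz : z ≠ 0) : Differentiable ℂ (entireFactor z) := by
  have h1 : Differentiable ℂ fun s : ℂ => (Gamma (1 - 2 * s))⁻¹ :=
    differentiable_one_div_Gamma.comp (f := fun s : ℂ => 1 - 2 * s) (by fun_prop)
  refine h1.mul fun s => ?_
  exact (differentiableAt_id.neg).const_cpow (Or.inl hz)

theorem exists_norm_entireFactor_le {z : ℂ} (hz : z ≠ 0) (T : ℝ) :
    ∃ C, 0 ≤ C ∧ ∀ r t : ℝ, r ≤ 1 → |t| ≤ T →
      ‖entireFactor z (r + t * I)‖ ≤ C * Real.exp r := by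
  set L := log z
  -- Chosen so that `exp (-M (1 - 2 r))` times `exp (-r L.re)` is `exp (-M) * exp r`.
  set M : ℝ := (1 + L.re) / 2
  obtain ⟨C, hC0, hC⟩ := exists_norm_Gamma_inv_le (2 * T) M
  refine ⟨C * Real.exp (-M) * Real.exp (T * |L.im|), by positivity, fun r t hr ht => ?_⟩
  have h1 := hC (1 - 2 * (r + t * I)) (by simp; linarith) (by simpa [abs_mul] using ht)
  have h2 : ‖z ^ (-((r : ℂ) + t * I))‖ ≤ Real.exp (-r * L.re) * Real.exp (T * |L.im|) := by
    rw [cpow_def_of_ne_zero hz, norm_exp, ← Real.exp_add]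
    refine Real.exp_le_exp.2 ?_
    have : t * L.im ≤ T * |L.im| :=
      (le_abs_self _).trans (by rw [abs_mul]; gcongr)
    have e : (log z * -((r : ℂ) + t * I)).re = -r * L.re + t * L.im := by
      simp [L]; ring
    linarith
  rw [entireFactor, norm_mul]
  calc _ ≤ C * Real.exp (-M * (1 - 2 * ((r : ℂ) + t * I)).re) *
        (Real.exp (-r * L.re) * Real.exp (T * |L.im|)) := by gcongr
    _ = C * Real.exp (T * |L.im|) *
        (Real.exp (-M * (1 - 2 * ((r : ℂ) + t * I)).re) * Real.exp (-r * L.re)) := by ring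
    _ = C * Real.exp (T * |L.im|) * (Real.exp (-M) * Real.exp r) := by
        rw [← Real.exp_add, ← Real.exp_add]
        congr 2
        simp [M]; ring
    _ = _ := by ring

/-! ### Lower bounds for the sine. -/

/-- The `sinh` term bounds the sine below on horizontal lines, the `sin` term on half-integer
vertical lines. -/
theorem normSq_sin_add_mul_I (x y : ℝ) :
    normSq (sin (x + y * I)) = Real.sin x ^ 2 + Real.sinh y ^ 2 := by
  have e : sin (x + y * I) =
      ((Real.sin x * Real.cosh y : ℝ) : ℂ) + ((Real.cos x * Real.sinh y : ℝ) : ℂ) * I := by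
    rw [sin_add_mul_I]; push_cast; ring
  rw [e, normSq_add_mul_I, mul_pow, mul_pow, Real.cosh_sq, Real.cos_sq']
  ring

theorem sin_pi_mul_ne_zero_of_im_ne_zero {s : ℂ} (hs : s.im ≠ 0) : sin (Real.pi * s) ≠ 0 := by
  intro h
  obtain ⟨k, hk⟩ := sin_eq_zero_iff.1 h
  have hs' : s = k := mul_left_cancel₀ (ofReal_ne_zero.2 Real.pi_ne_zero) (by rw [hk, mul_comm])
  exact hs (by simp [hs'])

theorem sin_pi_mul_ne_zero_of_re_ne_int {s : ℂ} (hs : ∀ k : ℤ, s.re ≠ k) :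
    sin (Real.pi * s) ≠ 0 := by
  intro h
  obtain ⟨k, hk⟩ := sin_eq_zero_iff.1 h
  have hs' : s = k := mul_left_cancel₀ (ofReal_ne_zero.2 Real.pi_ne_zero) (by rw [hk, mul_comm])
  exact hs k (by simp [hs'])

theorem norm_pi_div_sin_horizontal_le (r : ℝ) {t : ℝ} (ht : t ≠ 0) :
    ‖(Real.pi : ℂ) / sin (Real.pi * (r + t * I))‖ ≤ Real.pi / |Real.sinh (Real.pi * t)| := by
  have hs : 0 < |Real.sinh (Real.pi * t)| :=
    abs_pos.2 (Real.sinh_ne_zero.2 (mul_ne_zero Real.pi_ne_zero ht))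
  rw [norm_div, norm_real, Real.norm_of_nonneg Real.pi_pos.le]
  gcongr
  have h := normSq_sin_add_mul_I (Real.pi * r) (Real.pi * t)
  rw [normSq_eq_norm_sq] at h
  have e : (Real.pi : ℂ) * (r + t * I) = ((Real.pi * r : ℝ) : ℂ) + ((Real.pi * t : ℝ) : ℂ) * I := by
    push_cast; ring
  rw [e]
  refine abs_le_of_sq_le_sq (by nlinarith [sq_nonneg (Real.sin (Real.pi * r))]) (norm_nonneg _)

theorem norm_pi_div_sin_vertical_le (k : ℕ) (t : ℝ) :
    ‖(Real.pi : ℂ) / sin (Real.pi * (((-k - 1 / 2 : ℝ) : ℂ) + t * I))‖ ≤ Real.pi := by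
  rw [norm_div, norm_real, Real.norm_of_nonneg Real.pi_pos.le]
  refine div_le_self Real.pi_pos.le ?_
  have h := normSq_sin_add_mul_I (Real.pi * (-k - 1 / 2)) (Real.pi * t)
  have h1 : Real.sin (Real.pi * (-k - 1 / 2)) ^ 2 = 1 := by
    have e : Real.pi * (-k - 1 / 2) = -(Real.pi / 2 + k * Real.pi) := by ring
    rw [e, Real.sin_neg, Real.sin_add_nat_mul_pi, Real.sin_pi_div_two, neg_sq, mul_one, ← pow_mul,
      mul_comm, pow_mul, neg_one_sq, one_pow]
  rw [normSq_eq_norm_sq, h1] at h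
  have e : (Real.pi : ℂ) * (((-k - 1 / 2 : ℝ) : ℂ) + t * I) =
      ((Real.pi * (-k - 1 / 2) : ℝ) : ℂ) + ((Real.pi * t : ℝ) : ℂ) * I := by
    push_cast; ring
  rw [e]
  exact one_le_sq_iff₀ (norm_nonneg _) |>.1 (by nlinarith [sq_nonneg (Real.sinh (Real.pi * t))])

/-! ### The kernel, its poles and its integrability. -/

/-- Isolates the pole at `-k`: the numerator is holomorphic for `|Re (s + k)| < 1` and equals `(-1)
^ k` at `s = -k`. -/
theorem pi_div_sin_eq (k : ℕ) (s : ℂ) :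
    (Real.pi : ℂ) / sin (Real.pi * s) =
      (-1) ^ k * (Gamma (1 + (s + k)) * Gamma (1 - (s + k))) / (s - (-k : ℂ)) := by
  have hsin : sin (Real.pi * (s + k)) = (-1) ^ k * sin (Real.pi * s) := by
    rw [mul_add, mul_comm (Real.pi : ℂ) k, sin_antiperiodic.add_nat_mul_eq]
  have hsq : ((-1 : ℂ) ^ k) * (-1) ^ k = 1 := by
    rw [← mul_pow, neg_one_mul, neg_neg, one_pow]
  have hs : sin (Real.pi * s) = (-1) ^ k * sin (Real.pi * (s + k)) := by
    rw [hsin, ← mul_assoc, hsq, one_mul]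
  rw [sub_neg_eq_add, hs]
  by_cases h : s + k = 0
  -- At the pole both sides are divisions by zero, hence `0`.
  · simp [h]
  · have hG := Gamma_mul_Gamma_one_sub (s + k)
    have hinv : ((-1 : ℂ) ^ k)⁻¹ = (-1) ^ k := inv_eq_of_mul_eq_one_left hsq
    rw [add_comm 1 (s + k), Gamma_add_one _ h, mul_assoc, hG, div_mul_eq_div_div_swap,
      div_eq_mul_inv _ ((-1 : ℂ) ^ k), hinv]
    field_simp

/-- The function `π z ^ (-s) / (sin (π s) Γ(1 - 2 s))`. -/
noncomputable def coshKernel (z s : ℂ) : ℂ := Real.pi / sin (Real.pi * s) * entireFactor z s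

/-- The reflection formula; it holds even at the integers, where both sides take the default value
`0`. -/
theorem foxIntegrand_eq_coshKernel (z : ℂ) :
    foxIntegrand 1 1 ![0] ![1] ![0, 0] ![1, 2] z = coshKernel z := by
  funext s
  simp [foxIntegrand, foxKernel, coshKernel, entireFactor, ← Gamma_mul_Gamma_one_sub]
  ring

theorem continuousAt_coshKernel {z s : ℂ} (hz : z ≠ 0) (hs : sin (Real.pi * s) ≠ 0) :
    ContinuousAt (coshKernel z) s := by
  have h : ContinuousAt (fun s : ℂ => sin (Real.pi * s)) s := by fun_prop
  exact (continuousAt_const.div h hs).mul (differentiable_entireFactor hz).continuous.continuousAt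

theorem continuous_coshKernel_horizontal {z : ℂ} (hz : z ≠ 0) {t : ℝ} (ht : t ≠ 0) :
    Continuous fun r : ℝ => coshKernel z (r + t * I) :=
  continuous_iff_continuousAt.2 fun r =>
    (continuousAt_coshKernel hz (sin_pi_mul_ne_zero_of_im_ne_zero (by simpa using ht))).comp
      (f := fun r : ℝ => (r : ℂ) + t * I) (by fun_prop)

theorem continuous_coshKernel_vertical {z : ℂ} (hz : z ≠ 0) {c : ℝ} (hc0 : 0 < c) (hc1 : c < 1) :
    Continuous fun t : ℝ => coshKernel z (c + t * I) :=
  continuous_iff_continuousAt.2 fun t =>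
    (continuousAt_coshKernel hz (sin_pi_mul_ne_zero_of_re_ne_int (by
      intro k hk
      simp at hk
      rw [hk] at hc0 hc1
      norm_cast at hc0 hc1
      omega))).comp
      (f := fun t : ℝ => (c : ℂ) + t * I) (by fun_prop)

theorem integrableOn_coshKernel_horizontal {z : ℂ} (hz : z ≠ 0) {c t : ℝ} (hc : c ≤ 1)
    (ht : t ≠ 0) : IntegrableOn (fun r : ℝ => coshKernel z (r + t * I)) (Iic c) := by
  obtain ⟨C, hC0, hC⟩ := exists_norm_entireFactor_le hz |t|
  refine Integrable.mono' ((integrableOn_exp_Iic c).const_mul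
    (Real.pi / |Real.sinh (Real.pi * t)| * C))
    (continuous_coshKernel_horizontal hz ht).aestronglyMeasurable ?_
  refine (ae_restrict_iff' measurableSet_Iic).2 (Eventually.of_forall fun r hr => ?_)
  rw [coshKernel, norm_mul, mul_assoc]
  gcongr
  · exact norm_pi_div_sin_horizontal_le r ht
  · exact hC r t (le_trans hr hc) le_rfl

theorem entireFactor_neg_natCast (z : ℂ) (k : ℕ) :
    entireFactor z (-k) = z ^ k / ((Nat.factorial (2 * k) : ℕ) : ℂ) := by
  have e : (1 : ℂ) - 2 * -(k : ℂ) = ((2 * k : ℕ) : ℂ) + 1 := by push_cast; ring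
  rw [entireFactor, e, Gamma_nat_eq_factorial, neg_neg, cpow_natCast, div_eq_mul_inv, mul_comm]

/-! ### Residues and the limit of the rectangles. -/

theorem rectBoundaryIntegral_coshKernel {z : ℂ} (hz : z ≠ 0) (k : ℕ) {a b u v : ℝ}
    (ha : -k - 1 < a) (ha' : a < -k) (hb : -k < b) (hb' : b < -k + 1) (hu : u < 0) (hv : 0 < v) :
    rectBoundaryIntegral (coshKernel z) a b u v =
      2 * Real.pi * I * ((-z) ^ k / ((Nat.factorial (2 * k) : ℕ) : ℂ)) := by
  set h : ℂ → ℂ := fun s =>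
    (-1) ^ k * (Gamma (1 + (s + k)) * Gamma (1 - (s + k))) * entireFactor z s with hh
  have hf : coshKernel z = fun s => h s / (s - (-k : ℂ)) := by
    funext s
    rw [coshKernel, pi_div_sin_eq k s, hh]
    ring
  have hU : IsOpen {s : ℂ | s.re ∈ Ioo (-k - 1 : ℝ) (-k + 1)} :=
    isOpen_Ioo.preimage continuous_re
  have hd : DifferentiableOn ℂ h {s : ℂ | s.re ∈ Ioo (-k - 1 : ℝ) (-k + 1)} := by
    intro s hs
    obtain ⟨h1, h2⟩ := hs
    have d1 : DifferentiableAt ℂ (fun s : ℂ => Gamma (1 + (s + k))) s := by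
      refine (differentiableAt_Gamma _ fun m e => ?_).comp (f := fun s : ℂ => 1 + (s + k)) s
        (by fun_prop)
      have := congrArg re e
      simp at this
      linarith [m.cast_nonneg (α := ℝ)]
    have d2 : DifferentiableAt ℂ (fun s : ℂ => Gamma (1 - (s + k))) s := by
      refine (differentiableAt_Gamma _ fun m e => ?_).comp (f := fun s : ℂ => 1 - (s + k)) s
        (by fun_prop)
      have := congrArg re e
      simp at this
      linarith [m.cast_nonneg (α := ℝ)]
    exact (((d1.mul d2).const_mul _).mul (differentiable_entireFactor hz s)).differentiableWithinAt
  rw [hf, rectBoundaryIntegral_div_sub hU (fun s hs => ⟨ha.trans_le hs.1, hs.2.trans_lt hb'⟩) hd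
    (by simpa using ha') (by simpa using hb) (by simpa using hu) (by simpa using hv)]
  simp only [hh, neg_add_cancel, add_zero, sub_zero, Gamma_one, mul_one, entireFactor_neg_natCast]
  rw [neg_pow z]
  ring

/-- The shared vertical edge cancels formally, so continuity is needed only on the horizontal lines.
-/
theorem rectBoundaryIntegral_add {f : ℂ → ℂ} {a b c u v : ℝ}
    (hu : Continuous fun r : ℝ => f (r + u * I)) (hv : Continuous fun r : ℝ => f (r + v * I)) :
    rectBoundaryIntegral f a b u v + rectBoundaryIntegral f b c u v =
      rectBoundaryIntegral f a c u v := by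
  simp only [rectBoundaryIntegral]
  rw [← intervalIntegral.integral_add_adjacent_intervals (hu.intervalIntegrable a b)
      (hu.intervalIntegrable b c),
    ← intervalIntegral.integral_add_adjacent_intervals (hv.intervalIntegrable a b)
      (hv.intervalIntegrable b c)]
  ring

theorem rectBoundaryIntegral_coshKernel_eq_sum {z : ℂ} (hz : z ≠ 0) (n : ℕ) {c u v : ℝ}
    (hc : 0 < c) (hc' : c < 1) (hu : u < 0) (hv : 0 < v) :
    rectBoundaryIntegral (coshKernel z) (-n - 1 / 2) c u v =
      2 * Real.pi * I *
        ∑ k ∈ Finset.range (n + 1), (-z) ^ k / ((Nat.factorial (2 * k) : ℕ) : ℂ) := by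
  induction n with
  | zero =>
    have h := rectBoundaryIntegral_coshKernel hz 0 (a := -(0 : ℕ) - 1 / 2) (b := c) (u := u)
      (v := v) (by norm_num) (by norm_num) (by simpa using hc) (by simpa using hc') hu hv
    rw [h]
    simp
  | succ n ih =>
    rw [Finset.sum_range_succ, mul_add, ← ih, add_comm (rectBoundaryIntegral _ _ _ _ _),
      ← rectBoundaryIntegral_coshKernel hz (n + 1) (a := -(n + 1 : ℕ) - 1 / 2) (b := -n - 1 / 2)
        (by linarith) (by linarith) (by push_cast; linarith) (by push_cast; linarith) hu hv]
    exact (rectBoundaryIntegral_add (continuous_coshKernel_horizontal hz hu.ne)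
      (continuous_coshKernel_horizontal hz hv.ne')).symm

/-- On these edges the sine quotient is at most `π` in norm and the entire factor is `O(exp (-n))`.
-/
theorem tendsto_integral_coshKernel_vertical {z : ℂ} (hz : z ≠ 0) (u v : ℝ) :
    Tendsto (fun n : ℕ => ∫ t in u..v, coshKernel z ((-n - 1 / 2 : ℝ) + t * I)) atTop (𝓝 0) := by
  obtain ⟨C, hC0, hC⟩ := exists_norm_entireFactor_le hz (max |u| |v|)
  have hlim : Tendsto (fun n : ℕ => Real.pi * (C * Real.exp (-n - 1 / 2)) * |v - u|) atTop
      (𝓝 (Real.pi * (C * 0) * |v - u|)) := by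
    refine ((Tendsto.const_mul _ ?_).const_mul _).mul_const _
    refine Real.tendsto_exp_atBot.comp ?_
    exact tendsto_atBot_add_const_right _ _ (tendsto_neg_atTop_atBot.comp tendsto_natCast_atTop_atTop)
  rw [mul_zero, mul_zero, zero_mul] at hlim
  refine squeeze_zero_norm (fun n => ?_) hlim
  refine intervalIntegral.norm_integral_le_of_norm_le_const fun t ht => ?_
  rw [coshKernel, norm_mul]
  gcongr
  · exact norm_pi_div_sin_vertical_le n t
  · refine hC _ t (by linarith [n.cast_nonneg (α := ℝ)]) ?_
    rcases le_total u v with h | h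
    · rw [uIoc_of_le h] at ht
      exact abs_le_max_abs_abs ht.1.le ht.2
    · rw [uIoc_of_ge h] at ht
      rw [max_comm]
      exact abs_le_max_abs_abs ht.1.le ht.2

theorem leftLoopIntegral_coshKernel_of_hasSum {z w : ℂ} (hz : z ≠ 0)
    (hw : HasSum (fun k : ℕ => (-z) ^ k / ((Nat.factorial (2 * k) : ℕ) : ℂ)) w) {c u v : ℝ}
    (hc : 0 < c) (hc' : c < 1) (hu : u < 0) (hv : 0 < v) :
    leftLoopIntegral (coshKernel z) c u v = 2 * Real.pi * I * w := by
  have hbot : Tendsto (fun n : ℕ => (-n - 1 / 2 : ℝ)) atTop atBot :=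
    tendsto_atBot_add_const_right _ _ (tendsto_neg_atTop_atBot.comp tendsto_natCast_atTop_atTop)
  have h1 := intervalIntegral_tendsto_integral_Iic c
    (integrableOn_coshKernel_horizontal hz hc'.le hu.ne) hbot
  have h2 := intervalIntegral_tendsto_integral_Iic c
    (integrableOn_coshKernel_horizontal hz hc'.le hv.ne') hbot
  have h3 := (tendsto_integral_coshKernel_vertical hz u v).const_mul I
  have hL := ((h1.sub h2).add_const (I * ∫ t in u..v, coshKernel z (c + t * I))).sub h3
  have hR := (hw.tendsto_sum_nat.comp (tendsto_add_atTop_nat 1)).const_mul (2 * Real.pi * I)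
  have heq := tendsto_nhds_unique hL (hR.congr fun n =>
    (rectBoundaryIntegral_coshKernel_eq_sum hz n hc hc' hu hv).symm)
  rw [← heq, leftLoopIntegral]
  ring

/-! ### The H-function and the hyperbolic cosine. -/

/-- The left poles are `0, -1, -2, …` and the right ones `1, 2, …`, so the poles `0` and `1` decide.
-/
theorem isLeftLoop_cosh_iff {c u v : ℝ} :
    IsLeftLoop 1 1 ![0] ![1] ![0, 0] ![1, 2] c u v ↔ 0 < c ∧ c < 1 ∧ u < 0 ∧ 0 < v := by
  constructor
  · rintro ⟨-, hl, hr⟩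
    have h0 := hl 0 ⟨0, by simp, 0, by simp⟩
    have h1 := hr 1 ⟨0, by simp, 0, by simp⟩
    simp at h0 h1
    exact ⟨h0.1, h1, h0.2.1, h0.2.2⟩
  · rintro ⟨h0, h1, hu, hv⟩
    refine ⟨hu.trans hv, ?_, ?_⟩
    · rintro s ⟨j, hj, k, rfl⟩
      obtain rfl : j = 0 := by ext; simpa using hj
      have := k.cast_nonneg (α := ℝ)
      simp
      exact ⟨by linarith, hu, hv⟩
    · rintro s ⟨j, hj, k, rfl⟩
      obtain rfl : j = 0 := by ext; simp
      have := k.cast_nonneg (α := ℝ)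
      simp
      linarith

theorem hasFoxH_of_hasSum {z w : ℂ} (hz : z ≠ 0)
    (hw : HasSum (fun k : ℕ => (-z) ^ k / ((Nat.factorial (2 * k) : ℕ) : ℂ)) w) :
    HasFoxH 1 1 ![0] ![1] ![0, 0] ![1, 2] z w := by
  refine ⟨by norm_num, le_rfl, by simp, by simp [Fin.forall_fin_two], hz, Or.inl ⟨Or.inl ?_, ?_, ?_⟩⟩
  · simp [foxDelta]
  · exact ⟨1 / 2, -1, 1, isLeftLoop_cosh_iff.2 (by norm_num)⟩
  · intro c u v h
    obtain ⟨hc, hc', hu, hv⟩ := isLeftLoop_cosh_iff.1 h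
    rw [foxIntegrand_eq_coshKernel]
    refine ⟨⟨integrableOn_coshKernel_horizontal hz hc'.le hu.ne,
      (continuous_coshKernel_vertical hz hc hc').intervalIntegrable _ _,
      integrableOn_coshKernel_horizontal hz hc'.le hv.ne'⟩, ?_⟩
    rw [leftLoopIntegral_coshKernel_of_hasSum hz hw hc hc' hu hv, ← mul_assoc,
      inv_mul_cancel₀ two_pi_I_ne_zero, one_mul]

/-- Multiplying an exponent by a natural number gives a power on every branch, so no condition on
`x` arises, not even `x ≠ 0`. -/
theorem hasSum_cpow_div_factorial (x α : ℂ) :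
    HasSum (fun k : ℕ => x ^ (α * (k : ℂ)) / ((Nat.factorial (2 * k) : ℕ) : ℂ))
      (cosh (x ^ (α / 2))) := by
  convert hasSum_cosh (x ^ (α / 2)) using 3 with k
  rw [cpow_mul_nat, pow_mul, ← cpow_mul_nat _ _ 2]
  congr 2
  push_cast
  ring

theorem mainTheorem4 (x : ℝ) (α : ℂ) (hx : x ≠ 0 ∨ 0 < α.re) :
    HasSum (fun k : ℕ => (x : ℂ) ^ (α * (k : ℂ)) / ((Nat.factorial (2 * k) : ℕ) : ℂ))
      (Complex.cosh ((x : ℂ) ^ (α / 2))) ∧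
    (x ≠ 0 →
      HasFoxH 1 1 ![0] ![1] ![0, 0] ![1, 2] (-(x : ℂ) ^ α)
        (foxH 1 1 ![0] ![1] ![0, 0] ![1, 2] (-(x : ℂ) ^ α)) ∧
      HasSum (fun k : ℕ => (x : ℂ) ^ (α * (k : ℂ)) / ((Nat.factorial (2 * k) : ℕ) : ℂ))
        (foxH 1 1 ![0] ![1] ![0, 0] ![1, 2] (-(x : ℂ) ^ α)) ∧
      foxH 1 1 ![0] ![1] ![0, 0] ![1, 2] (-(x : ℂ) ^ α) =
        1 / 2 * Complex.exp ((x : ℂ) ^ (α / 2)) + 1 / 2 * Complex.exp (-(x : ℂ) ^ (α / 2)) ∧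
      foxH 1 1 ![0] ![1] ![0, 0] ![1, 2] (-(x : ℂ) ^ α) =
        Complex.cosh ((x : ℂ) ^ (α / 2))) := by
  have hsum := hasSum_cpow_div_factorial x α
  refine ⟨hsum, fun hx0 => ?_⟩
  have hx' : (x : ℂ) ≠ 0 := ofReal_ne_zero.2 hx0
  have hz : -(x : ℂ) ^ α ≠ 0 := neg_ne_zero.2 fun h => hx' ((cpow_eq_zero_iff _ _).1 h).1
  have hH := hasFoxH_of_hasSum hz (w := cosh ((x : ℂ) ^ (α / 2)))
    (by simpa only [neg_neg, ← cpow_mul_nat] using hsum)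
  rw [hH.foxH_eq]
  refine ⟨hH, hsum, ?_, rfl⟩
  rw [cosh]
  ring
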